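/- Let $\mathbb U\subseteq\mathbb R^n$ be a nonempty compact set and let $\mathbb Y\subseteq\mathbb R^m$ be a nonempty Borel set. On a probability space let $\omega_0$ be a random variable with values in a standard Borel space $\Omega_0$, and let $y^1,y^2,\dots$ be $\mathbb Y$-valued random variables that are i.i.d. conditionally on $\omega_0$. Suppose that there are a probability measure $Q$ on $\mathbb Y$ and a measurable function $f\ge 0$ on $\mathbb Y\times\Omega_0$ such that, for almost every $\omega_0$, the conditional distribution of each $y^i$ given $\omega_0$ is $f(y,\omega_0)\,Q(dy)$. Let $\mu^N$ be the joint law of $(\omega_0,y^1,\dots,y^N)$. Let $c:\Omega_0\times\mathbb U\times\mathrm{conv}(\mathbb U)\to[0,\infty)$ be measurable and bounded, and suppose that for every $\omega_0$ the map $(u,a)\mapsto c(\omega_0,u,a)$ is (jointly) continuous. Let $\Gamma$ be the set of probability measures on $\mathbb U\times\mathbb Y$ of the form $\gamma(du\mid y)\,Q(dy)$, where $\gamma(du\mid y)$ is a stochastic kernel from $\mathbb Y$ to $\mathbb U$, with the topology of weak convergence and its Borel $\sigma$-algebra; the element of $\Gamma$ given by such a kernel is denoted by $\gamma$. Let $L^N_{\mathrm{EX}}$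 be the set of probability measures on $\Gamma^N$ that are invariant under all permutations of the $N$ coordinates. Let $L_{\mathrm{EX}}$ be the set of probability measures $P$ on $\Gamma^{\mathbb N}$ such that, for every $N$, the marginal $P_N$ of $P$ on the first $N$ coordinates is invariant under all permutations of these coordinates. For a probability measure $P$ on $\Gamma^N$ let $$J_N(P)=\int_{\Gamma^N}\int_{\Omega_0\times\mathbb Y^N}\left(\int_{\mathbb U^N}\frac1N\sum_{i=1}^N c\Big(\omega_0,u^i,\frac1N\sum_{p=1}^N u^p\Big)\prod_{k=1}^N\gamma^k(du^k\mid y^k)\right)\mu^N(d\omega_0,dy^1,\dots,dy^N)\,P(d\gamma^1,\dots,d\gamma^N).$$ Then $$\limsup_{N\to\infty}\ \inf_{P\in L^N_{\mathrm{EX}}}J_N(P)\;=\;\limsup_{N\to\infty}\ \inf_{P\in L_{\mathrm{EX}}}J_N(P_N).$$ -/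

import Mathlib

open MeasureTheory ProbabilityTheory Filter Topology
open scoped ENNReal NNReal

namespace ExchangeableTeam

noncomputable section

/-- The space `Γ` of (relaxed) policies of one decision maker, with action space `U` and observation
space `Y`: probability measures on `U × Y` of the form `Π(du | y) Q(dy)` for a stochastic kernel
`Π` from `Y` to `U`, where `Q` is the reference measure on the observation space. -/
def Policy {n m : ℕ} (U : Set (EuclideanSpace ℝ (Fin n))) {Y : Set (EuclideanSpace ℝ (Fin m))}
    (Q : Measure Y) : Type :=
  {P : ProbabilityMeasure (U × Y) //
    ∃ K : Kernel Y U, IsMarkovKernel K ∧ (P : Measure (U × Y)) = (Q ⊗ₘ K).map Prod.swap}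

/-- Policies carry the topology of weak convergence of the measures `γ(du | y) Q(dy)`. -/
instance Policy.instTopologicalSpace {n m : ℕ} (U : Set (EuclideanSpace ℝ (Fin n)))
    {Y : Set (EuclideanSpace ℝ (Fin m))} (Q : Measure Y) : TopologicalSpace (Policy U Q) :=
  instTopologicalSpaceSubtype

/-- The Borel `σ`-algebra of the weak topology. -/
instance Policy.instMeasurableSpace {n m : ℕ} (U : Set (EuclideanSpace ℝ (Fin n)))
    {Y : Set (EuclideanSpace ℝ (Fin m))} (Q : Measure Y) : MeasurableSpace (Policy U Q) :=
  borel (Policy U Q)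

instance Policy.instBorelSpace {n m : ℕ} (U : Set (EuclideanSpace ℝ (Fin n)))
    {Y : Set (EuclideanSpace ℝ (Fin m))} (Q : Measure Y) : BorelSpace (Policy U Q) :=
  ⟨rfl⟩

/-- The policy `γ` as a measure on (observation, action) pairs. -/
def Policy.joint {n m : ℕ} {U : Set (EuclideanSpace ℝ (Fin n))}
    {Y : Set (EuclideanSpace ℝ (Fin m))} {Q : Measure Y} (γ : Policy U Q) : Measure (Y × U) :=
  (γ.1 : Measure (U × Y)).map Prod.swap

instance Policy.instIsProbabilityMeasureJoint {n m : ℕ} {U : Set (EuclideanSpace ℝ (Fin n))}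
    {Y : Set (EuclideanSpace ℝ (Fin m))} {Q : Measure Y} (γ : Policy U Q) :
    IsProbabilityMeasure γ.joint :=
  Measure.isProbabilityMeasure_map measurable_swap.aemeasurable

theorem Policy.measurable_joint {n m : ℕ} (U : Set (EuclideanSpace ℝ (Fin n)))
    {Y : Set (EuclideanSpace ℝ (Fin m))} (Q : Measure Y) :
    Measurable (fun γ : Policy U Q => γ.joint) := by
  have key : Measurable (fun γ : Policy U Q => (γ.1 : Measure (U × Y))) := by
    refine Measurable.measure_of_isPiSystem_of_isProbabilityMeasure
      (S := {s | IsClosed s}) ?_ isPiSystem_isClosed ?_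
    · rw [← borel_eq_generateFrom_isClosed]
      exact BorelSpace.measurable_eq
    · intro F hF
      have hF' : IsClosed F := hF
      refine measurable_of_tendsto_metrizable
        (f := fun k (γ : Policy U Q) => ∫⁻ x, hF'.apprSeq k x ∂(γ.1 : Measure (U × Y))) ?_ ?_
      · intro k
        refine Continuous.measurable ?_
        rw [continuous_iff_continuousAt]
        intro γ
        have h : Tendsto (fun γ' : Policy U Q => γ'.1) (𝓝 γ) (𝓝 γ.1) :=
          continuous_subtype_val.continuousAt
        exact ProbabilityMeasure.tendsto_iff_forall_lintegral_tendsto.1 h (hF'.apprSeq k)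
      · rw [tendsto_pi_nhds]
        intro γ
        exact HasOuterApproxClosed.tendsto_lintegral_apprSeq hF' (γ.1 : Measure (U × Y))
  exact (Measure.measurable_map Prod.swap measurable_swap).comp key

/-- The tautological kernel `γ ↦ Q(dy) γ(du | y)`. -/
def jointKernel {n m : ℕ} (U : Set (EuclideanSpace ℝ (Fin n)))
    {Y : Set (EuclideanSpace ℝ (Fin m))} (Q : Measure Y) : Kernel (Policy U Q) (Y × U) where
  toFun γ := γ.joint
  measurable' := Policy.measurable_joint U Q

instance instIsMarkovKernelJointKernel {n m : ℕ} (U : Set (EuclideanSpace ℝ (Fin n)))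
    {Y : Set (EuclideanSpace ℝ (Fin m))} (Q : Measure Y) : IsMarkovKernel (jointKernel U Q) :=
  ⟨fun γ => inferInstanceAs (IsProbabilityMeasure γ.joint)⟩

/-- The conditional law `γ(du | y)` of the action given the observation under the policy `γ`, in a
version that is jointly measurable in `(γ, y)`. -/
def actionKernel {n m : ℕ} (U : Set (EuclideanSpace ℝ (Fin n)))
    {Y : Set (EuclideanSpace ℝ (Fin m))} (Q : Measure Y) [StandardBorelSpace U] [Nonempty U] :
    Kernel (Policy U Q × Y) U :=
  (jointKernel U Q).condKernel

/-- `L_EX^N`: the laws on `Γ^N` that are invariant under all permutations of the `N` decision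
makers. -/
def LEXN {n m : ℕ} (U : Set (EuclideanSpace ℝ (Fin n))) {Y : Set (EuclideanSpace ℝ (Fin m))}
    (Q : Measure Y) (N : ℕ) : Set (Measure (Fin N → Policy U Q)) :=
  {P | IsProbabilityMeasure P ∧
    ∀ σ : Equiv.Perm (Fin N), P.map (fun γ i => γ (σ i)) = P}

/-- The marginal `P_{π,N}` on the first `N` components of a law on `Γ^ℕ`. -/
def firstMarginal {n m : ℕ} {U : Set (EuclideanSpace ℝ (Fin n))}
    {Y : Set (EuclideanSpace ℝ (Fin m))} {Q : Measure Y} (N : ℕ)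
    (P : Measure (ℕ → Policy U Q)) : Measure (Fin N → Policy U Q) :=
  P.map (fun γ i => γ i)

/-- `L_EX`: the laws on `Γ^ℕ` all of whose marginals on the first `N` components are
exchangeable. -/
def LEX {n m : ℕ} (U : Set (EuclideanSpace ℝ (Fin n))) {Y : Set (EuclideanSpace ℝ (Fin m))}
    (Q : Measure Y) : Set (Measure (ℕ → Policy U Q)) :=
  {P | IsProbabilityMeasure P ∧
    ∀ (N : ℕ) (σ : Equiv.Perm (Fin N)),
      (firstMarginal N P).map (fun γ i => γ (σ i)) = firstMarginal N P}

/-- The mean-field cost `(1/N) ∑ᵢ c(ω₀, uⁱ, (1/N) ∑ₚ uᵖ)`. -/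
def meanFieldCost {n : ℕ} {U : Set (EuclideanSpace ℝ (Fin n))} {Ω₀ : Type*}
    (c : Ω₀ → EuclideanSpace ℝ (Fin n) → EuclideanSpace ℝ (Fin n) → ℝ≥0) (N : ℕ)
    (w : Ω₀) (u : Fin N → U) : ℝ≥0 :=
  (N : ℝ≥0)⁻¹ * ∑ i, c w (u i) ((N : ℝ)⁻¹ • ∑ p, (u p : EuclideanSpace ℝ (Fin n)))

/-- `c^N(γ, y, ω₀)`: the mean-field cost integrated against `∏ₖ γᵏ(duᵏ | yᵏ)`. -/
def policyCost {n m : ℕ} {U : Set (EuclideanSpace ℝ (Fin n))}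
    {Y : Set (EuclideanSpace ℝ (Fin m))} {Q : Measure Y} [StandardBorelSpace U] [Nonempty U]
    {Ω₀ : Type*} (c : Ω₀ → EuclideanSpace ℝ (Fin n) → EuclideanSpace ℝ (Fin n) → ℝ≥0) (N : ℕ)
    (γ : Fin N → Policy U Q) (v : Fin N → Y) (w : Ω₀) : ℝ≥0∞ :=
  ∫⁻ u, (meanFieldCost c N w u : ℝ≥0∞) ∂(Measure.pi fun k => actionKernel U Q (γ k, v k))

/-- `μ^N`: the joint law of `ω₀` and the first `N` observations. -/
def observationLaw {m : ℕ} {Y : Set (EuclideanSpace ℝ (Fin m))} {Ω Ω₀ : Type*}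
    [MeasurableSpace Ω] [MeasurableSpace Ω₀] (μ : Measure Ω) (ω₀ : Ω → Ω₀) (y : ℕ → Ω → Y)
    (N : ℕ) : Measure (Ω₀ × (Fin N → Y)) :=
  μ.map (fun ω => (ω₀ ω, fun i : Fin N => y i ω))

/-- The expected cost `∫ P(dγ) μ^N(dω₀, dy) c^N(γ, y, ω₀)` of a randomized policy `P` of the
`N`-decision-maker team. -/
def expectedCost {n m : ℕ} {U : Set (EuclideanSpace ℝ (Fin n))}
    {Y : Set (EuclideanSpace ℝ (Fin m))} {Q : Measure Y} [StandardBorelSpace U] [Nonempty U]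
    {Ω Ω₀ : Type*} [MeasurableSpace Ω] [MeasurableSpace Ω₀]
    (c : Ω₀ → EuclideanSpace ℝ (Fin n) → EuclideanSpace ℝ (Fin n) → ℝ≥0)
    (μ : Measure Ω) (ω₀ : Ω → Ω₀) (y : ℕ → Ω → Y) (N : ℕ)
    (P : Measure (Fin N → Policy U Q)) : ℝ≥0∞ :=
  ∫⁻ γ, ∫⁻ x, policyCost c N γ x.2 x.1 ∂(observationLaw μ ω₀ y N) ∂P

/-- The observations `y⁰, y¹, …` are i.i.d. conditionally on `ω₀`: for every `N`, the conditional
distribution of the first `N` of them given `ω₀` is the `N`-fold power of a single kernel. -/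
def ConditionallyIID {m : ℕ} {Y : Set (EuclideanSpace ℝ (Fin m))} [StandardBorelSpace Y]
    [Nonempty Y] {Ω Ω₀ : Type*} [MeasurableSpace Ω] [MeasurableSpace Ω₀]
    (μ : Measure Ω) [IsProbabilityMeasure μ] (ω₀ : Ω → Ω₀) (y : ℕ → Ω → Y) : Prop :=
  ∃ κ : Kernel Ω₀ Y, IsMarkovKernel κ ∧ ∀ N : ℕ, ∀ᵐ w ∂(μ.map ω₀),
    condDistrib (fun ω (i : Fin N) => y i ω) ω₀ μ w = Measure.pi (fun _ => κ w)

end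

end ExchangeableTeam

/-! One inequality holds because marginals of laws in `LEX` lie in `LEXN`. For the other, a law `P`
on `Γ^N` is made infinitely exchangeable by drawing policies from its `N` coordinates with
replacement (`resample`). It must be shown that this raises the cost by only `o(1)`.

Given `ω₀ = w` and the policies, the observations are i.i.d., so the actions are independent with
laws `ν_1, …, ν_N` (`lintegral_policyCost_pi`). The average action has variance `O(1/N)` around the
average `m` of the means, so the mean-field cost is within `ε` of `(1/N) ∑ ∫ c(w, v, m) ν_i(dv)`,
for all `N` large depending on `w` but not on the `ν_i` (`exists_abs_integral_meanField_sub_le`).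
Resampling, once the random indices are integrated out, replaces every `ν_i` by the mixture `(1/N) ∑
ν_i` (`bind_measure_pi`). This changes neither `m` nor that limiting expression, so the two costs
are asymptotically equal. No closeness of the laws of the policy vectors is needed: only their
mixture enters.

The threshold depends on `w`; dominated convergence, with the bound on `c`, removes this dependence.
Applying the result to near-minimizers for each team size concludes. -/

namespace ExchangeableTeam

/-! ### Concentration of the mean-field cost for independent actions -/

section Analysis

/-- Uniform continuity in a form suited to second moment estimates. -/
theorem exists_abs_sub_le_add_mul_norm_sq {E F : Type*} [PseudoMetricSpace E]
    [SeminormedAddCommGroup F] {S : Set E} {T : Set F} (hS : IsCompact S) (hT : IsCompact T)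
    {φ : E → F → ℝ} (hφ : ContinuousOn (fun p : E × F => φ p.1 p.2) (S ×ˢ T))
    {ε : ℝ} (hε : 0 < ε) :
    ∃ C : ℝ, 0 ≤ C ∧ ∀ u ∈ S, ∀ a ∈ T, ∀ b ∈ T, |φ u a - φ u b| ≤ ε + C * ‖a - b‖ ^ 2 := by
  obtain ⟨M, hM⟩ := (hS.prod hT).exists_bound_of_continuousOn hφ
  obtain ⟨δ, hδ, h⟩ := Metric.uniformContinuousOn_iff.1
    ((hS.prod hT).uniformContinuousOn_of_continuous hφ) ε hε
  -- At distance at least `δ` the trivial bound `2 * M` is absorbed by the quadratic term.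
  refine ⟨2 * |M| / δ ^ 2, by positivity, fun u hu a ha b hb => ?_⟩
  rcases lt_or_ge ‖a - b‖ δ with hab | hab
  · have := h (u, a) ⟨hu, ha⟩ (u, b) ⟨hu, hb⟩ (by
      rw [Prod.dist_eq]; simpa [dist_eq_norm, hδ] using hab)
    rw [Real.dist_eq] at this
    have : 0 ≤ 2 * |M| / δ ^ 2 * ‖a - b‖ ^ 2 := by positivity
    linarith
  · have h1 : |φ u a| ≤ M := hM (u, a) ⟨hu, ha⟩
    have h2 : |φ u b| ≤ M := hM (u, b) ⟨hu, hb⟩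
    have h3 : δ ^ 2 ≤ ‖a - b‖ ^ 2 := by gcongr
    have h4 : 2 * |M| ≤ 2 * |M| / δ ^ 2 * ‖a - b‖ ^ 2 := by
      rw [div_mul_eq_mul_div, le_div_iff₀ (by positivity)]
      gcongr
    have h5 := abs_sub (φ u a) (φ u b)
    have h6 := le_abs_self M
    linarith

/-- The convex hull of a compact set in a finite-dimensional space is compact. -/
theorem isCompact_convexHull_of_finiteDimensional {E : Type*} [NormedAddCommGroup E]
    [NormedSpace ℝ E] [FiniteDimensional ℝ E] {S : Set E} (hS : IsCompact S) :
    IsCompact (convexHull ℝ S) := by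
  -- Carathéodory: combinations of at most `d` points suffice, so the hull is a finite union of
  -- continuous images of compact sets.
  let d := Module.finrank ℝ E + 1
  have h : convexHull ℝ S = ⋃ k ∈ Finset.range (d + 1),
      (fun p : (Fin k → ℝ) × (Fin k → E) => ∑ i, p.1 i • p.2 i) ''
        (stdSimplex ℝ (Fin k) ×ˢ Set.univ.pi fun _ => S) := by
    ext x
    simp only [Set.mem_iUnion, Set.mem_image, Prod.exists, Set.mem_prod, Set.mem_univ_pi]
    constructor
    · intro hx
      obtain ⟨ι, _, z, w, hz, hai, hw0, hw1, rfl⟩ := eq_pos_convex_span_of_mem_convexHull hx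
      have hcard : Fintype.card ι ≤ d :=
        hai.card_le_finrank_succ.trans (Nat.succ_le_succ (Submodule.finrank_le _))
      let e := (Fintype.equivFin ι).symm
      refine ⟨Fintype.card ι, by simpa [Nat.lt_succ_iff] using hcard, w ∘ e, z ∘ e,
        ⟨⟨fun i => (hw0 _).le, ?_⟩, fun i => hz ⟨_, rfl⟩⟩, ?_⟩
      · exact (e.sum_comp w).trans hw1
      · exact e.sum_comp fun i => w i • z i
    · rintro ⟨k, -, w, z, ⟨hw, hz⟩, rfl⟩
      exact (convex_convexHull ℝ S).sum_mem (fun i _ => hw.1 i) hw.2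
        fun i _ => subset_convexHull ℝ S (hz i)
  rw [h]
  refine (Finset.range (d + 1)).isCompact_biUnion fun k _ => ?_
  exact ((isCompact_stdSimplex ℝ (Fin k)).prod (isCompact_univ_pi fun _ => hS)).image (by fun_prop)

variable {n : ℕ} {U : Set (EuclideanSpace ℝ (Fin n))}

theorem integrable_of_continuous_of_compactSpace {X F : Type*} [TopologicalSpace X] [CompactSpace X]
    [MeasurableSpace X] [OpensMeasurableSpace X] [SecondCountableTopology X]
    [NormedAddCommGroup F] {ν : Measure X} [IsFiniteMeasure ν]
    {g : X → F} (hg : Continuous g) : Integrable g ν :=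
  hg.integrable_of_hasCompactSupport (HasCompactSupport.of_compactSpace g)

/-- The average of independent random vectors in a bounded set has variance `O(1/N)`. -/
theorem integral_norm_sq_average_sub_mean_le (hU : IsCompact U) {R : ℝ}
    (hR : ∀ u ∈ U, ‖u‖ ≤ R) {N : ℕ} (ν : Fin N → Measure U)
    [∀ i, IsProbabilityMeasure (ν i)] :
    ∫ u, ‖(N : ℝ)⁻¹ • ∑ p, (u p : EuclideanSpace ℝ (Fin n)) -
      (N : ℝ)⁻¹ • ∑ p, ∫ x, (x : EuclideanSpace ℝ (Fin n)) ∂(ν p)‖ ^ 2 ∂(Measure.pi ν)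
      ≤ n * R ^ 2 * (N : ℝ)⁻¹ := by
  have : CompactSpace U := isCompact_iff_compactSpace.1 hU
  have hcoord : ∀ j : Fin n, Continuous fun x : U => (x : EuclideanSpace ℝ (Fin n)) j := by
    fun_prop
  -- Coordinatewise, variances of independent summands add: `N` terms of at most `R ^ 2`, scaled by
  -- `1 / N ^ 2`.
  have key : ∀ j : Fin n, ∫ u, ((N : ℝ)⁻¹ * ∑ p, (u p : EuclideanSpace ℝ (Fin n)) j -
      (N : ℝ)⁻¹ * ∑ p, ∫ x, (x : EuclideanSpace ℝ (Fin n)) j ∂(ν p)) ^ 2 ∂(Measure.pi ν)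
      ≤ R ^ 2 * (N : ℝ)⁻¹ := by
    intro j
    have hL : ∀ p, MemLp (fun x : U => (x : EuclideanSpace ℝ (Fin n)) j) 2 (ν p) := fun p =>
      (hcoord j).memLp_of_hasCompactSupport (HasCompactSupport.of_compactSpace _)
    have h1 := variance_sum_pi (μ := ν)
      (X := fun _ (x : U) => (x : EuclideanSpace ℝ (Fin n)) j) hL
    have h2 : ∀ p, Var[fun x : U => (x : EuclideanSpace ℝ (Fin n)) j; ν p] ≤ R ^ 2 := by
      intro p
      refine (variance_le_sq_of_bounded (a := -R) (b := R) (ae_of_all _ fun x => ?_)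
        (hcoord j).aemeasurable).trans (by ring_nf; rfl)
      have := (PiLp.norm_apply_le (x : EuclideanSpace ℝ (Fin n)) j).trans (hR x x.2)
      exact abs_le.1 this
    rw [variance_eq_integral (by fun_prop)] at h1
    have h3 : ∫ u, (∑ p : Fin N, (fun ω : Fin N → U => (ω p : EuclideanSpace ℝ (Fin n)) j)) u
        ∂(Measure.pi ν) = ∑ p, ∫ x, (x : EuclideanSpace ℝ (Fin n)) j ∂(ν p) := by
      simp only [Finset.sum_apply]
      rw [integral_finsetSum _ fun p _ =>
        integrable_of_continuous_of_compactSpace (by fun_prop)]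
      refine Finset.sum_congr rfl fun p _ => ?_
      exact integral_comp_eval (μ := ν) (hcoord j).aestronglyMeasurable
    rw [h3] at h1
    have h4 : ∀ u : Fin N → U, ((N : ℝ)⁻¹ * ∑ p, (u p : EuclideanSpace ℝ (Fin n)) j -
      (N : ℝ)⁻¹ * ∑ p, ∫ x, (x : EuclideanSpace ℝ (Fin n)) j ∂(ν p)) ^ 2 = (N : ℝ)⁻¹ ^ 2 *
        ((∑ p : Fin N, (fun ω : Fin N → U => (ω p : EuclideanSpace ℝ (Fin n)) j)) u -
          ∑ p, ∫ x, (x : EuclideanSpace ℝ (Fin n)) j ∂(ν p)) ^ 2 := by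
      intro u
      rw [Finset.sum_apply]
      ring
    simp_rw [h4]
    rw [integral_const_mul, h1]
    calc (N : ℝ)⁻¹ ^ 2 * ∑ p, Var[fun x : U => (x : EuclideanSpace ℝ (Fin n)) j; ν p]
        ≤ (N : ℝ)⁻¹ ^ 2 * ∑ p : Fin N, R ^ 2 := by gcongr with p; exact h2 p
      _ = R ^ 2 * (N : ℝ)⁻¹ := by
        rcases eq_or_ne N 0 with rfl | hN
        · simp
        · simp; field_simp
  have hmean : ∀ p j, (∫ x, (x : EuclideanSpace ℝ (Fin n)) ∂(ν p)) j =
      ∫ x, (x : EuclideanSpace ℝ (Fin n)) j ∂(ν p) := fun p j =>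
    ((EuclideanSpace.proj (𝕜 := ℝ) j : EuclideanSpace ℝ (Fin n) →L[ℝ] ℝ).integral_comp_comm
      (integrable_of_continuous_of_compactSpace continuous_subtype_val)).symm
  simp only [EuclideanSpace.real_norm_sq_eq, PiLp.sub_apply, PiLp.smul_apply, smul_eq_mul,
    WithLp.ofLp_sum, Finset.sum_apply, hmean]
  rw [integral_finsetSum _ fun j _ => integrable_of_continuous_of_compactSpace (by fun_prop)]
  calc _ ≤ ∑ j : Fin n, R ^ 2 * (N : ℝ)⁻¹ := Finset.sum_le_sum fun j _ => key j
    _ = _ := by simp; ring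

/-- For independent actions the mean-field cost is close to the cost against the deterministic
average of the expected actions, uniformly in the laws of the actions. -/
theorem exists_abs_integral_meanField_sub_le (hU : IsCompact U)
    {φ : EuclideanSpace ℝ (Fin n) → EuclideanSpace ℝ (Fin n) → ℝ}
    (hφ : ContinuousOn (fun p : EuclideanSpace ℝ (Fin n) × EuclideanSpace ℝ (Fin n) =>
      φ p.1 p.2) (U ×ˢ convexHull ℝ U)) {ε : ℝ} (hε : 0 < ε) :
    ∃ N₀ : ℕ, ∀ N ≥ N₀, ∀ ν : Fin N → Measure U, (∀ i, IsProbabilityMeasure (ν i)) →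
      |∫ u, (N : ℝ)⁻¹ * ∑ i, φ (u i) ((N : ℝ)⁻¹ • ∑ p, (u p : EuclideanSpace ℝ (Fin n)))
          ∂(Measure.pi ν) -
        (N : ℝ)⁻¹ * ∑ i, ∫ v, φ v ((N : ℝ)⁻¹ • ∑ p, ∫ x, (x : EuclideanSpace ℝ (Fin n)) ∂(ν p))
          ∂(ν i)| ≤ ε := by
  have : CompactSpace U := isCompact_iff_compactSpace.1 hU
  obtain ⟨R, hR⟩ := hU.isBounded.exists_norm_le
  have hUc := isCompact_convexHull_of_finiteDimensional hU
  obtain ⟨C, hC, hmod⟩ := exists_abs_sub_le_add_mul_norm_sq hU hUc hφ (half_pos hε)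
  -- Chosen so that `C` times the variance bound is at most `ε / 2`; the threshold `N₀ + 1` below
  -- also excludes `N = 0`.
  obtain ⟨N₀, hN₀⟩ := exists_nat_gt (C * (n * R ^ 2) / (ε / 2))
  refine ⟨N₀ + 1, fun N hN ν hν => ?_⟩
  have hN0 : 0 < (N : ℝ) := by exact_mod_cast (show 0 < N by omega)
  have avg_mem : ∀ z : Fin N → EuclideanSpace ℝ (Fin n), (∀ p, z p ∈ convexHull ℝ U) →
      (N : ℝ)⁻¹ • ∑ p, z p ∈ convexHull ℝ U := by
    intro z hz
    rw [Finset.smul_sum]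
    exact (convex_convexHull ℝ U).sum_mem (fun _ _ => by positivity) (by simp; field_simp)
      fun p _ => hz p
  set m := (N : ℝ)⁻¹ • ∑ p, ∫ x, (x : EuclideanSpace ℝ (Fin n)) ∂(ν p) with hm
  have hmem : m ∈ convexHull ℝ U := avg_mem _ fun p =>
    (convex_convexHull ℝ U).integral_mem hUc.isClosed
      (ae_of_all _ fun x => subset_convexHull ℝ U x.2)
      (integrable_of_continuous_of_compactSpace continuous_subtype_val)
  set a : (Fin N → U) → EuclideanSpace ℝ (Fin n) :=
    fun u => (N : ℝ)⁻¹ • ∑ p, (u p : EuclideanSpace ℝ (Fin n)) with ha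
  have haU : ∀ u, a u ∈ convexHull ℝ U := fun u =>
    avg_mem _ fun p => subset_convexHull ℝ U (u p).2
  have hac : Continuous a := by fun_prop
  have hc1 : Continuous fun v : U => φ v m :=
    hφ.comp_continuous (f := fun v : U => ((v : EuclideanSpace ℝ (Fin n)), m)) (by fun_prop)
      fun v => ⟨v.2, hmem⟩
  have hc2 : ∀ i, Continuous fun u : Fin N → U => φ (u i) (a u) := fun i =>
    hφ.comp_continuous (f := fun u : Fin N → U => ((u i : EuclideanSpace ℝ (Fin n)), a u))
      (by fun_prop) fun u => ⟨(u i).2, haU u⟩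
  have hc3 : ∀ i, Continuous fun u : Fin N → U => φ (u i) m := fun i =>
    hc1.comp (continuous_apply i)
  -- With `m` frozen, each term depends on one coordinate, so both costs become integrals over the
  -- same product measure and compare pointwise.
  have h1 : (N : ℝ)⁻¹ * ∑ i, ∫ v, φ v m ∂(ν i) =
      ∫ u, (N : ℝ)⁻¹ * ∑ i, φ (u i) m ∂(Measure.pi ν) := by
    rw [integral_const_mul, integral_finsetSum _ fun i _ =>
      integrable_of_continuous_of_compactSpace (hc3 i)]
    congr 1
    refine Finset.sum_congr rfl fun i _ => ?_
    exact (integral_comp_eval (μ := ν) (f := fun v : U => φ v m) hc1.aestronglyMeasurable).symm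
  have hi2 : Integrable (fun u => (N : ℝ)⁻¹ * ∑ i, φ (u i) (a u)) (Measure.pi ν) :=
    integrable_of_continuous_of_compactSpace
      (continuous_const.mul (continuous_finsetSum _ fun i _ => hc2 i))
  have hi3 : Integrable (fun u => (N : ℝ)⁻¹ * ∑ i, φ (u i) m) (Measure.pi ν) :=
    integrable_of_continuous_of_compactSpace
      (continuous_const.mul (continuous_finsetSum _ fun i _ => hc3 i))
  rw [h1, ← integral_sub hi2 hi3]
  have hpt : ∀ u : Fin N → U, ‖(N : ℝ)⁻¹ * ∑ i, φ (u i) (a u) - (N : ℝ)⁻¹ * ∑ i, φ (u i) m‖ ≤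
      ε / 2 + C * ‖a u - m‖ ^ 2 := by
    intro u
    rw [← mul_sub, ← Finset.sum_sub_distrib, norm_mul, norm_inv, Real.norm_natCast,
      inv_mul_le_iff₀ hN0]
    refine (norm_sum_le _ _).trans ?_
    calc _ ≤ ∑ i : Fin N, (ε / 2 + C * ‖a u - m‖ ^ 2) :=
          Finset.sum_le_sum fun i _ => hmod _ (u i).2 _ (haU u) _ hmem
      _ = _ := by simp [mul_add]
  have hint : Integrable (fun u => ‖a u - m‖ ^ 2) (Measure.pi ν) :=
    integrable_of_continuous_of_compactSpace (by fun_prop)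
  rw [← Real.norm_eq_abs]
  refine (norm_integral_le_of_norm_le ((integrable_const _).add (hint.const_mul C))
    (ae_of_all _ hpt)).trans ?_
  simp only [Pi.add_apply]
  rw [integral_add (integrable_const _) (hint.const_mul C), integral_const, integral_const_mul]
  have h2 := integral_norm_sq_average_sub_mean_le hU hR ν
  have h3 : C * ∫ u, ‖a u - m‖ ^ 2 ∂(Measure.pi ν) ≤ C * (n * R ^ 2 * (N : ℝ)⁻¹) := by
    gcongr
  have h4 : C * (n * R ^ 2 * (N : ℝ)⁻¹) ≤ ε / 2 := by
    have : (N₀ : ℝ) ≤ N := by exact_mod_cast (show N₀ ≤ N by omega)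
    rw [← mul_assoc, ← div_eq_mul_inv, div_le_iff₀ hN0]
    rw [div_lt_iff₀ (half_pos hε)] at hN₀
    nlinarith
  simp
  linarith

end Analysis

/-! ### Mixtures of product measures -/

section Product

variable {ι X Z : Type*} [Fintype ι] [MeasurableSpace X] [MeasurableSpace Z]

theorem measurable_measure_pi {K : ι → X → Measure Z} (hK : ∀ k, Measurable (K k))
    [∀ k x, IsProbabilityMeasure (K k x)] :
    Measurable fun x => Measure.pi fun k => K k x := by
  refine Measurable.measure_of_isPiSystem_of_isProbabilityMeasure generateFrom_pi.symm
    isPiSystem_pi ?_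
  rintro _ ⟨s, hs, rfl⟩
  simp_rw [Measure.pi_pi]
  exact Finset.measurable_prod _ fun k _ =>
    (Measure.measurable_coe (hs k (Set.mem_univ k))).comp (hK k)

theorem isProbabilityMeasure_bind {m : Measure X} [IsProbabilityMeasure m] {K : X → Measure Z}
    (hK : Measurable K) [∀ x, IsProbabilityMeasure (K x)] : IsProbabilityMeasure (m.bind K) :=
  ⟨by rw [Measure.bind_apply MeasurableSet.univ hK.aemeasurable]; simp⟩

/-- Mixing the factors of a product measure independently. -/
theorem bind_measure_pi (m : ι → Measure X) [∀ k, IsProbabilityMeasure (m k)]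
    {K : ι → X → Measure Z} (hK : ∀ k, Measurable (K k)) [∀ k x, IsProbabilityMeasure (K k x)] :
    (Measure.pi m).bind (fun x => Measure.pi fun k => K k (x k)) =
      Measure.pi fun k => (m k).bind (K k) := by
  have := fun k => isProbabilityMeasure_bind (m := m k) (hK k)
  have hmeas : Measurable fun x : ι → X => Measure.pi fun k => K k (x k) :=
    measurable_measure_pi fun k => (hK k).comp (measurable_pi_apply k)
  refine (Measure.pi_eq fun s hs => ?_).symm
  rw [Measure.bind_apply (MeasurableSet.univ_pi hs) hmeas.aemeasurable]
  simp_rw [Measure.pi_pi]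
  have hm : ∀ k, Measurable fun x => K k x (s k) := fun k =>
    (Measure.measurable_coe (hs k)).comp (hK k)
  -- On a box the integrand is a product of functions of separate coordinates, so its integral
  -- factorizes.
  have hind : iIndepFun (fun (k : ι) (x : ι → X) => K k (x k) (s k)) (Measure.pi m) :=
    iIndepFun_pi (X := fun k x => K k x (s k)) fun k => (hm k).aemeasurable
  rw [lintegral_prod_eq_prod_lintegral_of_indepFun Finset.univ _ hind
    fun k => (hm k).comp (measurable_pi_apply k)]
  refine Finset.prod_congr rfl fun k _ => ?_
  rw [Measure.bind_apply (hs k) (hK k).aemeasurable]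
  exact (measurePreserving_eval m k).lintegral_comp (hm k)

end Product

/-! ### Sampling with replacement -/

section Resampling

/-- The uniform distribution on `Fin N`. -/
noncomputable def uniformIndex (N : ℕ) : Measure (Fin N) := (N : ℝ≥0∞)⁻¹ • Measure.count

instance isProbabilityMeasure_uniformIndex (N : ℕ) [NeZero N] :
    IsProbabilityMeasure (uniformIndex N) :=
  ⟨by simp [uniformIndex, Measure.count_univ, ENNReal.inv_mul_cancel, NeZero.ne]⟩

theorem bind_uniformIndex {Z : Type*} [MeasurableSpace Z] {N : ℕ} (ν : Fin N → Measure Z) :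
    (uniformIndex N).bind ν = (N : ℝ≥0∞)⁻¹ • ∑ i, ν i := by
  ext s hs
  rw [Measure.bind_apply hs (measurable_of_finite ν).aemeasurable, uniformIndex,
    lintegral_smul_measure, lintegral_count]
  simp

theorem integral_bind_uniformIndex {Z F : Type*} [MeasurableSpace Z] [NormedAddCommGroup F]
    [NormedSpace ℝ F] {N : ℕ} (ν : Fin N → Measure Z) {g : Z → F}
    (hg : ∀ i, Integrable g (ν i)) :
    ∫ z, g z ∂((uniformIndex N).bind ν) = (N : ℝ)⁻¹ • ∑ i, ∫ z, g z ∂(ν i) := by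
  rw [bind_uniformIndex, integral_smul_measure, integral_finsetSum_measure fun i _ => hg i]
  simp

variable {Γ : Type*} [MeasurableSpace Γ]

/-- The law of the sequence obtained by sampling with replacement from the `N` coordinates of a
random vector. -/
noncomputable def resample (N : ℕ) [NeZero N] (P : Measure (Fin N → Γ)) : Measure (ℕ → Γ) :=
  (P.prod (Measure.infinitePi fun _ : ℕ => uniformIndex N)).map fun p j => p.1 (p.2 j)

theorem measurable_apply_apply {α : Type*} (N : ℕ) :
    Measurable fun (p : (Fin N → Γ) × (α → Fin N)) (j : α) => p.1 (p.2 j) := by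
  refine measurable_pi_lambda _ fun j => ?_
  have h : Measurable fun q : (Fin N → Γ) × Fin N => q.1 q.2 :=
    measurable_from_prod_countable_left fun i => measurable_pi_apply i
  exact h.comp (measurable_fst.prodMk ((measurable_pi_apply j).comp measurable_snd))

/-- Distinct coordinates of an i.i.d. sequence are again i.i.d.; injectivity of `g` is what keeps
them distinct. -/
theorem infinitePi_map_comp_injective {α ι : Type*} [Fintype α] {m : Measure Γ}
    [IsProbabilityMeasure m] {g : α → ι} (hg : Function.Injective g) :
    (Measure.infinitePi fun _ : ι => m).map (fun I i => I (g i)) = Measure.pi fun _ : α => m := by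
  have h := (iIndepFun_infinitePi (P := fun _ : ι => m) (X := fun _ x => x)
    fun _ => measurable_id).precomp hg
  have h2 := (iIndepFun_iff_map_fun_eq_pi_map fun i => (measurable_pi_apply (g i)).aemeasurable).1 h
  refine h2.trans ?_
  congr 1
  funext i
  exact Measure.infinitePi_map_eval _ (g i)

/-- The right-hand side does not involve `g`. Comparing the inclusion of `Fin M` in `ℕ` with its
composite with a permutation therefore gives exchangeability. -/
theorem resample_map_comp_injective {N M : ℕ} [NeZero N] (P : Measure (Fin N → Γ))
    [IsProbabilityMeasure P] {g : Fin M → ℕ} (hg : Function.Injective g) :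
    (resample N P).map (fun γ i => γ (g i)) =
      (P.prod (Measure.pi fun _ : Fin M => uniformIndex N)).map fun p j => p.1 (p.2 j) := by
  rw [resample, Measure.map_map (by fun_prop) (measurable_apply_apply N),
    ← infinitePi_map_comp_injective hg]
  nth_rw 2 [← Measure.map_id (μ := P)]
  rw [Measure.map_prod_map _ _ measurable_id (by fun_prop),
    Measure.map_map (measurable_apply_apply N) (by fun_prop)]
  rfl

instance isProbabilityMeasure_resample (N : ℕ) [NeZero N] (P : Measure (Fin N → Γ))
    [IsProbabilityMeasure P] : IsProbabilityMeasure (resample N P) :=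
  Measure.isProbabilityMeasure_map (measurable_apply_apply N).aemeasurable

end Resampling

/-! ### Exchangeable laws on policies -/

variable {n m : ℕ} {U : Set (EuclideanSpace ℝ (Fin n))} {Y : Set (EuclideanSpace ℝ (Fin m))}
  {Q : Measure Y}

theorem resample_mem_LEX (N : ℕ) [NeZero N] (P : Measure (Fin N → Policy U Q))
    [IsProbabilityMeasure P] : resample N P ∈ LEX U Q := by
  refine ⟨inferInstance, fun M σ => ?_⟩
  rw [firstMarginal, Measure.map_map (by fun_prop) (by fun_prop),
    resample_map_comp_injective P Fin.val_injective]
  exact resample_map_comp_injective P (Fin.val_injective.comp σ.injective)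

theorem firstMarginal_mem_LEXN (N : ℕ) {P : Measure (ℕ → Policy U Q)} (hP : P ∈ LEX U Q) :
    firstMarginal N P ∈ LEXN U Q N := by
  have := hP.1
  exact ⟨Measure.isProbabilityMeasure_map (Measurable.aemeasurable (by fun_prop)), hP.2 N⟩

theorem lintegral_firstMarginal_resample (N : ℕ) [NeZero N] (P : Measure (Fin N → Policy U Q))
    [IsProbabilityMeasure P] {F : (Fin N → Policy U Q) → ℝ≥0∞} (hF : Measurable F) :
    ∫⁻ γ, F γ ∂(firstMarginal N (resample N P)) =
      ∫⁻ γ, ∫⁻ I, F (fun i => γ (I i)) ∂(Measure.pi fun _ : Fin N => uniformIndex N) ∂P := by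
  rw [firstMarginal, resample_map_comp_injective P Fin.val_injective,
    lintegral_map hF (measurable_apply_apply N)]
  exact lintegral_prod _ (hF.comp (measurable_apply_apply N)).aemeasurable

/-- A Dirac mass at one constant policy repeated `N` times. This serves to make the infimum of the
bounded cost finite, so that near-minimizers exist. -/
theorem nonempty_LEXN [Nonempty U] [IsProbabilityMeasure Q] (N : ℕ) : (LEXN U Q N).Nonempty := by
  obtain ⟨u⟩ := ‹Nonempty U›
  let K : Kernel Y U := Kernel.const Y (Measure.dirac u)
  have hp : IsProbabilityMeasure ((Q ⊗ₘ K).map Prod.swap) :=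
    Measure.isProbabilityMeasure_map (by fun_prop)
  let γ : Policy U Q := ⟨⟨(Q ⊗ₘ K).map Prod.swap, hp⟩, K, inferInstance, rfl⟩
  refine ⟨Measure.dirac fun _ => γ, inferInstance, fun σ => ?_⟩
  exact Measure.map_dirac' (by fun_prop) _

/-! ### Mean-field cost under resampling of the action laws -/

section Cost

variable {n : ℕ} {U : Set (EuclideanSpace ℝ (Fin n))} {Ω₀ : Type*}
  {c : Ω₀ → EuclideanSpace ℝ (Fin n) → EuclideanSpace ℝ (Fin n) → ℝ≥0}

theorem average_mem_convexHull {N : ℕ} [NeZero N] (u : Fin N → U) :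
    (N : ℝ)⁻¹ • ∑ p, (u p : EuclideanSpace ℝ (Fin n)) ∈ convexHull ℝ U := by
  have hN : (N : ℝ) ≠ 0 := NeZero.ne _
  rw [Finset.smul_sum]
  exact (convex_convexHull ℝ U).sum_mem (fun _ _ => by positivity) (by simp [hN])
    fun p _ => subset_convexHull ℝ U (u p).2

theorem measurable_meanFieldCost [MeasurableSpace Ω₀] (N : ℕ) [NeZero N]
    (hcm : Measurable (fun p : Ω₀ × U × convexHull ℝ U => c p.1 p.2.1 p.2.2)) :
    Measurable fun p : Ω₀ × (Fin N → U) => meanFieldCost c N p.1 p.2 := by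
  refine Measurable.const_mul (Finset.measurable_sum _ fun i _ => ?_) _
  have ha : Measurable fun p : Ω₀ × (Fin N → U) =>
      (N : ℝ)⁻¹ • ∑ p', (p.2 p' : EuclideanSpace ℝ (Fin n)) := by fun_prop
  -- Measurability of `c` is given only on `Ω₀ × U × conv U`, so the average must be bundled as a
  -- point of the hull.
  have h : Measurable fun p : Ω₀ × (Fin N → U) =>
      ((p.1, p.2 i, ⟨_, average_mem_convexHull p.2⟩) : Ω₀ × U × convexHull ℝ U) :=
    measurable_fst.prodMk (((measurable_pi_apply i).comp measurable_snd).prodMk ha.subtype_mk)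
  exact hcm.comp h

theorem continuous_meanFieldCost (N : ℕ) [NeZero N] {w : Ω₀}
    (hcc : ContinuousOn (fun p : EuclideanSpace ℝ (Fin n) × EuclideanSpace ℝ (Fin n) =>
      c w p.1 p.2) (U ×ˢ convexHull ℝ U)) :
    Continuous fun u : Fin N → U => meanFieldCost c N w u := by
  refine continuous_const.mul (continuous_finsetSum _ fun i _ => ?_)
  exact hcc.comp_continuous (f := fun u : Fin N → U => ((u i : EuclideanSpace ℝ (Fin n)),
    (N : ℝ)⁻¹ • ∑ p, (u p : EuclideanSpace ℝ (Fin n)))) (by fun_prop)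
    fun u => ⟨(u i).2, average_mem_convexHull u⟩

theorem meanFieldCost_le (N : ℕ) [NeZero N] {w : Ω₀} {M : ℝ≥0}
    (hM : ∀ u ∈ U, ∀ a ∈ convexHull ℝ U, c w u a ≤ M) (u : Fin N → U) :
    meanFieldCost c N w u ≤ M := by
  have hN : (N : ℝ≥0) ≠ 0 := NeZero.ne _
  calc _ ≤ (N : ℝ≥0)⁻¹ * ∑ _i : Fin N, M := by
        unfold meanFieldCost
        gcongr with i
        exact hM _ (u i).2 _ (average_mem_convexHull u)
    _ = M := by simp [hN]

/-- Sampling the laws of the independent actions with replacement hardly increases the mean-field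
cost, uniformly in these laws. -/
theorem exists_lintegral_resampled_meanFieldCost_le (hU : IsCompact U) {w : Ω₀}
    (hcc : ContinuousOn (fun p : EuclideanSpace ℝ (Fin n) × EuclideanSpace ℝ (Fin n) =>
      c w p.1 p.2) (U ×ˢ convexHull ℝ U)) {ε : ℝ} (hε : 0 < ε) :
    ∃ N₀ : ℕ, ∀ N ≥ N₀, ∀ [NeZero N], ∀ ν : Fin N → Measure U,
      (∀ i, IsProbabilityMeasure (ν i)) →
      ∫⁻ I, ∫⁻ u, meanFieldCost c N w u ∂(Measure.pi fun i => ν (I i))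
        ∂(Measure.pi fun _ => uniformIndex N) ≤
      ∫⁻ u, meanFieldCost c N w u ∂(Measure.pi ν) + ENNReal.ofReal ε := by
  have : CompactSpace U := isCompact_iff_compactSpace.1 hU
  have hccR : ContinuousOn (fun p : EuclideanSpace ℝ (Fin n) × EuclideanSpace ℝ (Fin n) =>
      (c w p.1 p.2 : ℝ)) (U ×ˢ convexHull ℝ U) := NNReal.continuous_coe.comp_continuousOn hcc
  obtain ⟨N₀, hN₀⟩ := exists_abs_integral_meanField_sub_le (φ := fun u a => (c w u a : ℝ)) hU
    hccR (half_pos hε)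
  refine ⟨N₀, fun N hN _ ν hν => ?_⟩
  have hNR : (N : ℝ) ≠ 0 := NeZero.ne _
  have hcont := continuous_meanFieldCost N hcc
  set ν' : Measure U := (uniformIndex N).bind ν with hν'
  have hprob : IsProbabilityMeasure ν' := isProbabilityMeasure_bind (measurable_of_finite ν)
  have hbind : (Measure.pi fun _ : Fin N => uniformIndex N).bind
      (fun I => Measure.pi fun i => ν (I i)) = Measure.pi fun _ : Fin N => ν' :=
    bind_measure_pi (K := fun _ => ν) _ fun _ => measurable_of_finite ν
  have hleft : ∫⁻ I, ∫⁻ u, meanFieldCost c N w u ∂(Measure.pi fun i => ν (I i))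
      ∂(Measure.pi fun _ => uniformIndex N) =
      ∫⁻ u, meanFieldCost c N w u ∂(Measure.pi fun _ : Fin N => ν') := by
    rw [← hbind, Measure.lintegral_bind (measurable_of_finite _).aemeasurable]
    exact hcont.measurable.coe_nnreal_ennreal.aemeasurable
  rw [hleft]
  have hint : ∀ ρ : Measure (Fin N → U), IsFiniteMeasure ρ →
      Integrable (fun u => (meanFieldCost c N w u : ℝ)) ρ := fun ρ _ =>
    integrable_of_continuous_of_compactSpace (NNReal.continuous_coe.comp hcont)
  rw [lintegral_coe_eq_integral _ (hint _ inferInstance),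
    lintegral_coe_eq_integral _ (hint _ inferInstance),
    ← ENNReal.ofReal_add (integral_nonneg fun _ => NNReal.coe_nonneg _) hε.le]
  refine ENNReal.ofReal_le_ofReal ?_
  have h1 := hN₀ N hN ν hν
  have h2 := hN₀ N hN (fun _ => ν') fun _ => hprob
  have hcoe : ∀ u : Fin N → U, (meanFieldCost c N w u : ℝ) = (N : ℝ)⁻¹ *
      ∑ i, (c w (u i) ((N : ℝ)⁻¹ • ∑ p, (u p : EuclideanSpace ℝ (Fin n))) : ℝ) := by
    intro u
    simp [meanFieldCost]
  simp_rw [← hcoe] at h1 h2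
  -- The mixture has the same average mean, hence (`hcost`) the same limiting cost; each of the two
  -- products is within `ε / 2` of it.
  have hmean : (N : ℝ)⁻¹ • ∑ _p : Fin N, ∫ x, (x : EuclideanSpace ℝ (Fin n)) ∂ν' =
      (N : ℝ)⁻¹ • ∑ p, ∫ x, (x : EuclideanSpace ℝ (Fin n)) ∂(ν p) := by
    rw [hν', integral_bind_uniformIndex ν fun i =>
      integrable_of_continuous_of_compactSpace continuous_subtype_val, Finset.sum_const,
      Finset.card_univ, Fintype.card_fin, ← Nat.cast_smul_eq_nsmul ℝ, inv_smul_smul₀ hNR]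
  rw [hmean] at h2
  set b := (N : ℝ)⁻¹ • ∑ p, ∫ x, (x : EuclideanSpace ℝ (Fin n)) ∂(ν p) with hb
  have hbmem : b ∈ convexHull ℝ U := by
    rw [hb, Finset.smul_sum]
    exact (convex_convexHull ℝ U).sum_mem (fun _ _ => by positivity) (by simp [hNR])
      fun p _ => (convex_convexHull ℝ U).integral_mem
        (isCompact_convexHull_of_finiteDimensional hU).isClosed
        (ae_of_all _ fun x => subset_convexHull ℝ U x.2)
        (integrable_of_continuous_of_compactSpace continuous_subtype_val)
  have hcb : Continuous fun v : U => (c w v b : ℝ) :=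
    hccR.comp_continuous (f := fun v : U => ((v : EuclideanSpace ℝ (Fin n)), b)) (by fun_prop)
      fun v => ⟨v.2, hbmem⟩
  have hcost : (N : ℝ)⁻¹ * ∑ _i : Fin N, ∫ v, (c w v b : ℝ) ∂ν' =
      (N : ℝ)⁻¹ * ∑ i, ∫ v, (c w v b : ℝ) ∂(ν i) := by
    rw [hν', integral_bind_uniformIndex ν fun i =>
      integrable_of_continuous_of_compactSpace hcb]
    simp [hNR]
  rw [hcost] at h2
  rw [abs_le] at h1 h2
  linarith [h1.1, h1.2, h2.1, h2.2]

end Cost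

/-! ### Conditioning on the exogenous variable -/

section Policies

variable {n m : ℕ} {U : Set (EuclideanSpace ℝ (Fin n))} [StandardBorelSpace U] [Nonempty U]
  {Y : Set (EuclideanSpace ℝ (Fin m))} {Q : Measure Y}
  {Ω Ω₀ : Type*} [MeasurableSpace Ω] [MeasurableSpace Ω₀]
  {c : Ω₀ → EuclideanSpace ℝ (Fin n) → EuclideanSpace ℝ (Fin n) → ℝ≥0}

instance isMarkovKernel_actionKernel : IsMarkovKernel (actionKernel U Q) :=
  inferInstanceAs (IsMarkovKernel (jointKernel U Q).condKernel)

/-- The law of the action under a policy, given `ω₀`. -/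
@[irreducible] noncomputable def actionLaw (U : Set (EuclideanSpace ℝ (Fin n))) [StandardBorelSpace U]
    [Nonempty U] (Q : Measure Y) (κ : Kernel Ω₀ Y) : Kernel (Ω₀ × Policy U Q) U :=
  actionKernel U Q ∘ₖ
    (Kernel.deterministic Prod.snd measurable_snd ×ₖ κ.comap Prod.fst measurable_fst)

instance isMarkovKernel_actionLaw (κ : Kernel Ω₀ Y) [IsMarkovKernel κ] :
    IsMarkovKernel (actionLaw U Q κ) := by
  unfold actionLaw; infer_instance

theorem actionLaw_apply (κ : Kernel Ω₀ Y) [IsMarkovKernel κ] (w : Ω₀) (γ : Policy U Q) :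
    actionLaw U Q κ (w, γ) = (κ w).bind fun v => actionKernel U Q (γ, v) := by
  rw [actionLaw, Kernel.comp_apply, Kernel.prod_apply, Kernel.deterministic_apply,
    Kernel.comap_apply, Measure.dirac_prod]
  have hm : Measurable fun v => actionKernel U Q (γ, v) :=
    (Kernel.measurable _).comp measurable_prodMk_left
  ext s hs
  rw [Measure.bind_apply hs (Kernel.measurable _).aemeasurable,
    lintegral_map (Kernel.measurable_coe _ hs) measurable_prodMk_left,
    Measure.bind_apply hs hm.aemeasurable]

/-- The conditional expected cost given `ω₀ = w` when the observations have conditional law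
`κ w`. -/
@[irreducible] noncomputable def conditionalCost
    (c : Ω₀ → EuclideanSpace ℝ (Fin n) → EuclideanSpace ℝ (Fin n) → ℝ≥0)
    (κ : Kernel Ω₀ Y) (N : ℕ) (w : Ω₀) (γ : Fin N → Policy U Q) : ℝ≥0∞ :=
  ∫⁻ u, meanFieldCost c N w u ∂(Measure.pi fun k => actionLaw U Q κ (w, γ k))

theorem measurable_conditionalCost (κ : Kernel Ω₀ Y) [IsMarkovKernel κ] (N : ℕ) [NeZero N]
    (hcm : Measurable (fun p : Ω₀ × U × convexHull ℝ U => c p.1 p.2.1 p.2.2)) :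
    Measurable fun p : Ω₀ × (Fin N → Policy U Q) => conditionalCost c κ N p.1 p.2 := by
  let K : Kernel (Ω₀ × (Fin N → Policy U Q)) (Fin N → U) :=
    ⟨fun p => Measure.pi fun k => actionLaw U Q κ (p.1, p.2 k),
      measurable_measure_pi fun k => (Kernel.measurable _).comp (by fun_prop)⟩
  have : IsMarkovKernel K := ⟨fun p => inferInstanceAs (IsProbabilityMeasure (Measure.pi _))⟩
  have hf : Measurable fun q : (Ω₀ × (Fin N → Policy U Q)) × (Fin N → U) =>
      (meanFieldCost c N q.1.1 q.2 : ℝ≥0∞) :=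
    ((measurable_meanFieldCost N hcm).comp (by fun_prop :
      Measurable fun q : (Ω₀ × (Fin N → Policy U Q)) × (Fin N → U) =>
        (q.1.1, q.2))).coe_nnreal_ennreal
  unfold conditionalCost
  exact hf.lintegral_kernel_prod_right' (κ := K)

theorem measurable_policyCost (N : ℕ) [NeZero N] (γ : Fin N → Policy U Q)
    (hcm : Measurable (fun p : Ω₀ × U × convexHull ℝ U => c p.1 p.2.1 p.2.2)) :
    Measurable fun p : Ω₀ × (Fin N → Y) => policyCost c N γ p.2 p.1 := by
  let K : Kernel (Ω₀ × (Fin N → Y)) (Fin N → U) :=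
    ⟨fun p => Measure.pi fun k => actionKernel U Q (γ k, p.2 k),
      measurable_measure_pi fun k => (Kernel.measurable _).comp (by fun_prop)⟩
  have : IsMarkovKernel K := ⟨fun p => inferInstanceAs (IsProbabilityMeasure (Measure.pi _))⟩
  have hf : Measurable fun q : (Ω₀ × (Fin N → Y)) × (Fin N → U) =>
      (meanFieldCost c N q.1.1 q.2 : ℝ≥0∞) :=
    ((measurable_meanFieldCost N hcm).comp (by fun_prop :
      Measurable fun q : (Ω₀ × (Fin N → Y)) × (Fin N → U) => (q.1.1, q.2))).coe_nnreal_ennreal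
  exact hf.lintegral_kernel_prod_right' (κ := K)

/-- Independent observations fed into separate kernels give independent actions: this is
`bind_measure_pi` with `κ w` in every factor. -/
theorem lintegral_policyCost_pi (κ : Kernel Ω₀ Y) [IsMarkovKernel κ] (N : ℕ) [NeZero N]
    (hcm : Measurable (fun p : Ω₀ × U × convexHull ℝ U => c p.1 p.2.1 p.2.2)) (w : Ω₀)
    (γ : Fin N → Policy U Q) :
    ∫⁻ v, policyCost c N γ v w ∂(Measure.pi fun _ => κ w) = conditionalCost c κ N w γ := by
  have hK : ∀ k, Measurable fun v => actionKernel U Q (γ k, v) := fun k =>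
    (Kernel.measurable _).comp (by fun_prop)
  have hK' : Measurable fun v : Fin N → Y => Measure.pi fun k => actionKernel U Q (γ k, v k) :=
    measurable_measure_pi fun k => (hK k).comp (measurable_pi_apply k)
  have hf : Measurable fun u : Fin N → U => (meanFieldCost c N w u : ℝ≥0∞) :=
    ((measurable_meanFieldCost N hcm).comp measurable_prodMk_left).coe_nnreal_ennreal
  simp_rw [conditionalCost, actionLaw_apply]
  rw [← bind_measure_pi (fun _ => κ w) hK,
    Measure.lintegral_bind hK'.aemeasurable hf.aemeasurable]
  rfl

/-- Tonelli and disintegration of the observation law along `ω₀` put the integral over `w`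
outermost, as dominated convergence in `w` requires. -/
theorem expectedCost_eq [StandardBorelSpace Y] [Nonempty Y] {μ : Measure Ω}
    [IsProbabilityMeasure μ] {ω₀ : Ω → Ω₀} (hω₀ : Measurable ω₀) {y : ℕ → Ω → Y}
    (hy : ∀ i, Measurable (y i)) {κ : Kernel Ω₀ Y} [IsMarkovKernel κ] {N : ℕ} [NeZero N]
    (hκ : ∀ᵐ w ∂(μ.map ω₀),
      condDistrib (fun ω (i : Fin N) => y i ω) ω₀ μ w = Measure.pi (fun _ => κ w))
    (hcm : Measurable (fun p : Ω₀ × U × convexHull ℝ U => c p.1 p.2.1 p.2.2))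
    (P : Measure (Fin N → Policy U Q)) [IsProbabilityMeasure P] :
    expectedCost c μ ω₀ y N P = ∫⁻ w, ∫⁻ γ, conditionalCost c κ N w γ ∂P ∂(μ.map ω₀) := by
  have : IsProbabilityMeasure (μ.map ω₀) := Measure.isProbabilityMeasure_map hω₀.aemeasurable
  have hY : AEMeasurable (fun ω (i : Fin N) => y i ω) μ :=
    (measurable_pi_lambda _ fun i : Fin N => hy i).aemeasurable
  rw [lintegral_lintegral_swap (measurable_conditionalCost κ N hcm).aemeasurable]
  refine lintegral_congr fun γ => ?_
  rw [observationLaw, ← compProd_map_condDistrib hY,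
    Measure.lintegral_compProd (measurable_policyCost N γ hcm)]
  refine lintegral_congr_ae ?_
  filter_upwards [hκ] with w hw
  rw [hw]
  exact lintegral_policyCost_pi κ N hcm w γ

theorem conditionalCost_le (κ : Kernel Ω₀ Y) [IsMarkovKernel κ] (N : ℕ) [NeZero N] {w : Ω₀}
    {M : ℝ≥0} (hM : ∀ u ∈ U, ∀ a ∈ convexHull ℝ U, c w u a ≤ M) (γ : Fin N → Policy U Q) :
    conditionalCost c κ N w γ ≤ M := by
  unfold conditionalCost
  refine (lintegral_mono fun u => ENNReal.coe_le_coe.2 (meanFieldCost_le N hM u)).trans ?_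
  simp


theorem measurable_conditionalCost_right (κ : Kernel Ω₀ Y) [IsMarkovKernel κ] (N : ℕ) [NeZero N]
    (hcm : Measurable (fun p : Ω₀ × U × convexHull ℝ U => c p.1 p.2.1 p.2.2)) (w : Ω₀) :
    Measurable fun γ : Fin N → Policy U Q => conditionalCost c κ N w γ :=
  (measurable_conditionalCost κ N hcm).comp (measurable_prodMk_left (x := w))

/-- Resampling costs asymptotically nothing, conditionally on `ω₀ = w`. -/
theorem tendsto_resample_sub (hU : IsCompact U)
    (hcm : Measurable (fun p : Ω₀ × U × convexHull ℝ U => c p.1 p.2.1 p.2.2)) {w : Ω₀}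
    (hcc : ContinuousOn (fun p : EuclideanSpace ℝ (Fin n) × EuclideanSpace ℝ (Fin n) =>
      c w p.1 p.2) (U ×ˢ convexHull ℝ U))
    (κ : Kernel Ω₀ Y) [IsMarkovKernel κ] (P : ∀ N : ℕ, Measure (Fin (N + 1) → Policy U Q))
    [∀ N, IsProbabilityMeasure (P N)] :
    Tendsto (fun N => (∫⁻ γ, conditionalCost c κ (N + 1) w γ
        ∂(firstMarginal (N + 1) (resample (N + 1) (P N)))) -
      ∫⁻ γ, conditionalCost c κ (N + 1) w γ ∂(P N)) atTop (𝓝 0) := by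
  refine ENNReal.tendsto_nhds_zero.2 fun ε hε => ?_
  obtain ⟨δ, hδ, hδε⟩ : ∃ δ : ℝ, 0 < δ ∧ ENNReal.ofReal δ ≤ ε := by
    obtain ⟨δ, hδ, h⟩ := ENNReal.lt_iff_exists_nnreal_btwn.1 hε
    exact ⟨δ, by exact_mod_cast hδ, by simpa using h.le⟩
  obtain ⟨N₀, hN₀⟩ := exists_lintegral_resampled_meanFieldCost_le hU hcc hδ
  filter_upwards [eventually_ge_atTop N₀] with N hN
  have hmeas : Measurable fun γ : Fin (N + 1) → Policy U Q =>
      conditionalCost c κ (N + 1) w γ :=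
    measurable_conditionalCost_right κ (N + 1) hcm w
  rw [tsub_le_iff_left, lintegral_firstMarginal_resample (N + 1) (P N) hmeas]
  have hle : ∀ γ : Fin (N + 1) → Policy U Q,
      ∫⁻ I, conditionalCost c κ (N + 1) w (fun i => γ (I i))
        ∂(Measure.pi fun _ => uniformIndex (N + 1)) ≤
      conditionalCost c κ (N + 1) w γ + ENNReal.ofReal δ := by
    unfold conditionalCost
    -- Uniformity in the action laws lets one `N₀` serve every `γ`, hence every `P N`.
    exact fun γ => hN₀ (N + 1) (Nat.le_succ_of_le hN) (fun i => actionLaw U Q κ (w, γ i)) fun i => inferInstance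
  refine (lintegral_mono hle).trans ?_
  rw [lintegral_add_right _ measurable_const, lintegral_const, measure_univ, mul_one]
  gcongr

/-- Resampling costs asymptotically nothing. -/
theorem tendsto_lintegral_resample_sub {ρ : Measure Ω₀} [IsFiniteMeasure ρ] (hU : IsCompact U)
    (hcm : Measurable (fun p : Ω₀ × U × convexHull ℝ U => c p.1 p.2.1 p.2.2))
    (hcc : ∀ w, ContinuousOn (fun p : EuclideanSpace ℝ (Fin n) × EuclideanSpace ℝ (Fin n) =>
      c w p.1 p.2) (U ×ˢ convexHull ℝ U))
    (hcb : ∃ M : ℝ≥0, ∀ w, ∀ u ∈ U, ∀ a ∈ convexHull ℝ U, c w u a ≤ M)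
    (κ : Kernel Ω₀ Y) [IsMarkovKernel κ] (P : ∀ N : ℕ, Measure (Fin (N + 1) → Policy U Q))
    [∀ N, IsProbabilityMeasure (P N)] :
    Tendsto (fun N => ∫⁻ w, ((∫⁻ γ, conditionalCost c κ (N + 1) w γ
        ∂(firstMarginal (N + 1) (resample (N + 1) (P N)))) -
      ∫⁻ γ, conditionalCost c κ (N + 1) w γ ∂(P N)) ∂ρ) atTop (𝓝 0) := by
  obtain ⟨M, hM⟩ := hcb
  have hprob : ∀ N, IsProbabilityMeasure (firstMarginal (N + 1) (resample (N + 1) (P N))) :=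
    fun N => (firstMarginal_mem_LEXN (N + 1) (resample_mem_LEX (N + 1) (P N))).1
  rw [← lintegral_zero (μ := ρ)]
  -- The truncated difference is at most its first term, hence at most `M`.
  refine tendsto_lintegral_of_dominated_convergence (fun _ => M) (fun N => ?_) (fun N => ?_)
    (by simp [ENNReal.mul_eq_top]) ?_
  · exact ((measurable_conditionalCost κ (N + 1) hcm).lintegral_prod_right').sub
      ((measurable_conditionalCost κ (N + 1) hcm).lintegral_prod_right')
  · refine ae_of_all _ fun w => tsub_le_self.trans ?_
    refine (lintegral_mono fun γ => conditionalCost_le κ (N + 1) (hM w) γ).trans ?_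
    simp
  · exact ae_of_all _ fun w => tendsto_resample_sub hU hcm (hcc w) κ P

end Policies

/-! ### Comparison of the optimal values -/

/-- Restricting to infinitely exchangeable randomizations costs asymptotically nothing. -/
theorem limsup_iInf_LEX_le {n m : ℕ} {U : Set (EuclideanSpace ℝ (Fin n))} [StandardBorelSpace U]
    [Nonempty U] {Y : Set (EuclideanSpace ℝ (Fin m))} [StandardBorelSpace Y] [Nonempty Y]
    {Ω Ω₀ : Type*} [MeasurableSpace Ω] [MeasurableSpace Ω₀]
    {μ : Measure Ω} [IsProbabilityMeasure μ] {ω₀ : Ω → Ω₀} (hω₀ : Measurable ω₀)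
    {y : ℕ → Ω → Y} (hy : ∀ i, Measurable (y i)) {Q : Measure Y} [IsProbabilityMeasure Q]
    (hiid : ConditionallyIID μ ω₀ y) (hU : IsCompact U)
    {c : Ω₀ → EuclideanSpace ℝ (Fin n) → EuclideanSpace ℝ (Fin n) → ℝ≥0}
    (hcm : Measurable (fun p : Ω₀ × U × convexHull ℝ U => c p.1 p.2.1 p.2.2))
    (hcc : ∀ w, ContinuousOn (fun p : EuclideanSpace ℝ (Fin n) × EuclideanSpace ℝ (Fin n) =>
      c w p.1 p.2) (U ×ˢ convexHull ℝ U))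
    (hcb : ∃ M : ℝ≥0, ∀ w, ∀ u ∈ U, ∀ a ∈ convexHull ℝ U, c w u a ≤ M) :
    limsup (fun N : ℕ => ⨅ P ∈ LEX U Q, expectedCost c μ ω₀ y N (firstMarginal N P)) atTop ≤
      limsup (fun N : ℕ => ⨅ P ∈ LEXN U Q N, expectedCost c μ ω₀ y N P) atTop := by
  obtain ⟨κ, _, hκ⟩ := hiid
  have : IsProbabilityMeasure (μ.map ω₀) := Measure.isProbabilityMeasure_map hω₀.aemeasurable
  have hcost : ∀ (N : ℕ) (P : Measure (Fin (N + 1) → Policy U Q)), IsProbabilityMeasure P →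
      expectedCost c μ ω₀ y (N + 1) P =
        ∫⁻ w, ∫⁻ γ, conditionalCost c κ (N + 1) w γ ∂P ∂(μ.map ω₀) :=
    fun N P _ => expectedCost_eq hω₀ hy (hκ (N + 1)) hcm P
  obtain ⟨M, hM⟩ := id hcb
  have hfin : ∀ N : ℕ, ⨅ P ∈ LEXN U Q (N + 1), expectedCost c μ ω₀ y (N + 1) P ≠ ⊤ := by
    intro N
    obtain ⟨P, hP⟩ := nonempty_LEXN (U := U) (Q := Q) (N + 1)
    have := hP.1
    refine ((iInf₂_le P hP).trans_lt ?_).ne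
    rw [hcost N P hP.1]
    refine (lintegral_mono fun w => lintegral_mono fun γ =>
      conditionalCost_le κ (N + 1) (hM w) γ).trans_lt ?_
    simp
  -- Teams are indexed by `N + 1` to avoid the empty one. The slack `1 / N` is infinite at `N = 0`,
  -- which is harmless in the limit.
  have hnear : ∀ N : ℕ, ∃ P ∈ LEXN U Q (N + 1), expectedCost c μ ω₀ y (N + 1) P ≤
      (⨅ P ∈ LEXN U Q (N + 1), expectedCost c μ ω₀ y (N + 1) P) + (N : ℝ≥0∞)⁻¹ := by
    intro N
    have h := ENNReal.lt_add_right (hfin N) (ENNReal.inv_ne_zero.2 (ENNReal.natCast_ne_top N))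
    obtain ⟨P, h⟩ := iInf_lt_iff.1 h
    obtain ⟨hP, hlt⟩ := iInf_lt_iff.1 h
    exact ⟨P, hP, hlt.le⟩
  choose P hP hPle using hnear
  have hPp : ∀ N, IsProbabilityMeasure (P N) := fun N => (hP N).1
  have hδ := (ENNReal.tendsto_inv_nat_nhds_zero).add
    (tendsto_lintegral_resample_sub (ρ := μ.map ω₀) hU hcm hcc hcb κ P)
  rw [add_zero] at hδ
  set δ : ℕ → ℝ≥0∞ := fun N => (N : ℝ≥0∞)⁻¹ + ∫⁻ w, ((∫⁻ γ, conditionalCost c κ (N + 1) w γ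
        ∂(firstMarginal (N + 1) (resample (N + 1) (P N)))) -
      ∫⁻ γ, conditionalCost c κ (N + 1) w γ ∂(P N)) ∂(μ.map ω₀) with hδdef
  have hmain : ∀ N : ℕ,
      ⨅ R ∈ LEX U Q, expectedCost c μ ω₀ y (N + 1) (firstMarginal (N + 1) R) ≤
      (⨅ R ∈ LEXN U Q (N + 1), expectedCost c μ ω₀ y (N + 1) R) + δ N := by
    intro N
    have hmem := resample_mem_LEX (N + 1) (P N)
    refine (iInf₂_le _ hmem).trans ?_
    rw [hcost N _ (firstMarginal_mem_LEXN (N + 1) hmem).1, hδdef, ← add_assoc]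
    refine le_trans ?_ (add_le_add_left (hPle N) _)
    rw [hcost N (P N) (hPp N), ← lintegral_add_left
      ((measurable_conditionalCost κ (N + 1) hcm).lintegral_prod_right')]
    -- Only an upper bound on the resampled cost is needed, so truncated subtraction loses nothing.
    exact lintegral_mono fun w => le_add_tsub
  refine ENNReal.le_of_forall_pos_le_add fun ε hε _ => ?_
  rw [← limsup_add_const atTop _ (ε : ℝ≥0∞) (by isBoundedDefault) (by isBoundedDefault)]
  refine limsup_le_limsup ?_
  have hev := ENNReal.tendsto_nhds_zero.1 hδ ε (by exact_mod_cast hε)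
  filter_upwards [eventually_ge_atTop 1, (tendsto_sub_atTop_nat 1).eventually hev] with N h1 hN
  obtain ⟨K, rfl⟩ := Nat.exists_eq_add_of_le' h1
  rw [Nat.add_sub_cancel] at hN
  exact (hmain K).trans (by gcongr)

end ExchangeableTeam

theorem mainTheorem8 {n m : ℕ}
    -- action space and observation space
    (U : Set (EuclideanSpace ℝ (Fin n))) [StandardBorelSpace U] [Nonempty U]
    (Y : Set (EuclideanSpace ℝ (Fin m))) [StandardBorelSpace Y] [Nonempty Y]
    -- the underlying probability space, the exogenous variable and the observations
    {Ω Ω₀ : Type*} [MeasurableSpace Ω] [MeasurableSpace Ω₀] [StandardBorelSpace Ω₀]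
    (μ : Measure Ω) [IsProbabilityMeasure μ]
    (ω₀ : Ω → Ω₀) (hω₀ : Measurable ω₀)
    (y : ℕ → Ω → Y) (hy : ∀ i, Measurable (y i))
    -- absolute continuity of the observations with respect to a reference measure
    (Q : Measure Y) [IsProbabilityMeasure Q]
    (f : Y → Ω₀ → ℝ≥0∞) (hf : Measurable (Function.uncurry f))
    (hac : ∀ i, ∀ᵐ w ∂(μ.map ω₀), ∀ B : Set Y, MeasurableSet B →
      condDistrib (y i) ω₀ μ w B = ∫⁻ v in B, f v w ∂Q)
    -- conditionally i.i.d. observations, compact action space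
    (hiid : ExchangeableTeam.ConditionallyIID μ ω₀ y)
    (hU : IsCompact U)
    -- the cost on `Ω₀ × U × conv U`: measurable, continuous in the last two arguments, bounded
    (c : Ω₀ → EuclideanSpace ℝ (Fin n) → EuclideanSpace ℝ (Fin n) → ℝ≥0)
    (hcm : Measurable (fun p : Ω₀ × U × convexHull ℝ U => c p.1 p.2.1 p.2.2))
    (hcc : ∀ w, ContinuousOn (fun p : EuclideanSpace ℝ (Fin n) × EuclideanSpace ℝ (Fin n) =>
      c w p.1 p.2) (U ×ˢ convexHull ℝ U))
    (hcb : ∃ M : ℝ≥0, ∀ w, ∀ u ∈ U, ∀ a ∈ convexHull ℝ U, c w u a ≤ M) :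
    limsup (fun N : ℕ => ⨅ P ∈ ExchangeableTeam.LEXN U Q N,
        ExchangeableTeam.expectedCost c μ ω₀ y N P) atTop =
      limsup (fun N : ℕ => ⨅ P ∈ ExchangeableTeam.LEX U Q,
        ExchangeableTeam.expectedCost c μ ω₀ y N (ExchangeableTeam.firstMarginal N P)) atTop := by
  refine le_antisymm (limsup_le_limsup (Eventually.of_forall fun N => ?_))
    (ExchangeableTeam.limsup_iInf_LEX_le hω₀ hy hiid hU hcm hcc hcb)
  exact le_iInf₂ fun P hP => iInf₂_le _ (ExchangeableTeam.firstMarginal_mem_LEXN N hP)
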